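/- A signed graph on $[N]=\{1,\dots,N\}$ is a simple undirected graph each of whose edges is labelled $+$ or $-$. It is clusterable if $[N]$ can be partitioned, into any number of components, so that every positive edge has both ends in the same component and every negative edge joins two different components. It is $\epsilon$-far from being clusterable if at least $\epsilon N^2$ edge modifications (additions, removals or sign switches, each unordered pair of nodes counted once) are needed to make it clusterable, and $\epsilon$-close if at most $\epsilon N^2$ edge modifications suffice. Its weak frustration index is the minimum number of edges whose deletion makes it clusterable. In the dense signed graph model, a randomized (adaptive) algorithm that knows $N$ accesses the input graph $G$ by queries $(u,v)\in[N]^2$, answered by the entry in $\{0,-,+\}$ of the adjacency matrix of $G$; the query complexity is the worst-case number of queries, over all inputs and all random choices. **Theorem.** There are absolute constants $C>0$ and $c\in\mathbb N$ such that the following hold for every $N\ge 1$. 1. (Two-sided tolerant tester.) For all $0\le\epsilon_1<\epsilon_2\le 1$, with $\epsilon=\epsilon_2-\epsilon_1$, there is a randomized algorithm making at most $C\,\epsilon^{-7}(1+\log(1/\epsilon))^{c}=\widetilde O(1/\epsilon^7)$ queries which accepts with probability at least $2/3$ every signed graph on $[N]$ that is $\epsilon_1$-close to being clusterable, and rejects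 with probability at least $2/3$ every signed graph on $[N]$ that is $\epsilon_2$-far from being clusterable. 2. (Estimation.) For every $0<\epsilon\le 1$ there is a randomized algorithm making at most $C\,\epsilon^{-7}(1+\log(1/\epsilon))^{c}=\widetilde O(1/\epsilon^7)$ queries which, on every signed graph $G$ on $[N]$, outputs with probability at least $2/3$ a real number that differs from the weak frustration index of $G$ by at most $\epsilon N^2$. -/

import Mathlib

/-- A signed graph on the node set `[N]`, given by its symmetric adjacency matrix with entries in
`{0, -, +}`: the entry `0` means "no edge", `1` a positive edge and `-1` a negative edge.
There are no loops. -/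
@[ext]
structure SignedGraph (N : ℕ) where
  sign : Fin N → Fin N → SignType
  symm : ∀ u v, sign u v = sign v u
  loopless : ∀ v, sign v v = 0

namespace SignedGraph

variable {N : ℕ}

/-- A signed graph is clusterable (weakly balanced) if its nodes can be partitioned, into any
number of components, so that positive edges lie inside components and negative edges join
different components. A partition is given by its equivalence relation. -/
def IsClusterable (G : SignedGraph N) : Prop :=
  ∃ P : Setoid (Fin N), ∀ u v,
    (G.sign u v = 1 → P u v) ∧ (G.sign u v = -1 → ¬ P u v)

/-- The number of edge modifications (additions, removals, sign switches) that turn `G` into `H`;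
every unordered pair `{u, v}` is counted once. -/
def editDist (G H : SignedGraph N) : ℕ :=
  (Finset.univ.filter
    fun p : Fin N × Fin N => p.1 < p.2 ∧ G.sign p.1 p.2 ≠ H.sign p.1 p.2).card

/-- `G` is `ε`-far from `P`: at least `ε N ^ 2` edge modifications are needed to reach `P`. -/
def IsFar (ε : ℝ) (P : SignedGraph N → Prop) (G : SignedGraph N) : Prop :=
  ∀ H, P H → ε * (N : ℝ) ^ 2 ≤ (editDist G H : ℝ)

/-- `G` is `ε`-close to `P`: at most `ε N ^ 2` edge modifications suffice to reach `P`. -/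
def IsClose (ε : ℝ) (P : SignedGraph N → Prop) (G : SignedGraph N) : Prop :=
  ∃ H, P H ∧ (editDist G H : ℝ) ≤ ε * (N : ℝ) ^ 2

/-- `H` arises from `G` by deleting edges. -/
def IsDeletionOf (H G : SignedGraph N) : Prop :=
  ∀ u v, H.sign u v = G.sign u v ∨ H.sign u v = 0

/-- The weak frustration index: the minimum number of edges whose deletion makes `G`
clusterable. (Deleting all edges always works, so the set below is nonempty.) -/
noncomputable def weakFrustrationIndex (G : SignedGraph N) : ℕ :=
  sInf {m | ∃ H : SignedGraph N, H.IsDeletionOf G ∧ H.IsClusterable ∧ editDist G H = m}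

end SignedGraph

/-- A deterministic adaptive query algorithm (decision tree) with outputs in `α`, in the dense
signed graph model: it either stops with an output, or queries the entry `(u, v)` of the adjacency
matrix and continues according to the answer. -/
inductive QueryTree (N : ℕ) (α : Type) : Type
  | output (a : α) : QueryTree N α
  | query (u v : Fin N) (next : SignType → QueryTree N α) : QueryTree N α

namespace QueryTree

variable {N : ℕ} {α : Type}

/-- The output of the algorithm on the input graph `G`. -/
def run (G : SignedGraph N) : QueryTree N α → α
  | output a => a
  | query u v next => run G (next (G.sign u v))

/-- The worst-case number of queries. -/
def depth : QueryTree N α → ℕ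
  | output _ => 0
  | query _ _ next => Finset.univ.sup (fun s => depth (next s)) + 1

end QueryTree

/-- A randomized query algorithm: a random deterministic query algorithm. -/
abbrev RandomizedQueryAlg (N : ℕ) (α : Type) : Type := PMF (QueryTree N α)

namespace RandomizedQueryAlg

variable {N : ℕ} {α : Type}

/-- The probability that the output of `A` on input `G` lies in `S`. -/
noncomputable def prob (A : RandomizedQueryAlg N α) (G : SignedGraph N) (S : Set α) : ENNReal :=
  (PMF.map (QueryTree.run G) A).toOuterMeasure S

/-- `A` never makes more than `B` queries, whatever its random choices and the input. -/
def QueriesAtMost (A : RandomizedQueryAlg N α) (B : ℝ) : Prop :=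
  ∀ t ∈ PMF.support A, (QueryTree.depth t : ℝ) ≤ B

/-- `A` is a (two-sided error) tolerant tester for `P` with parameters `ε₁`, `ε₂`: it accepts
(outputs `true`) every graph that is `ε₁`-close to `P`, and rejects (outputs `false`) every graph
that is `ε₂`-far from `P`, each with probability at least `2 / 3`. -/
def IsTolerantTester (A : RandomizedQueryAlg N Bool) (P : SignedGraph N → Prop)
    (ε₁ ε₂ : ℝ) : Prop :=
  (∀ G : SignedGraph N, G.IsClose ε₁ P → 2 / 3 ≤ A.prob G {true}) ∧
    (∀ G : SignedGraph N, G.IsFar ε₂ P → 2 / 3 ≤ A.prob G {false})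

/-- `A` estimates the graph parameter `f` with additive error at most `Δ`, with probability at
least `2 / 3` on every input graph. -/
def IsEstimator (A : RandomizedQueryAlg N ℝ) (f : SignedGraph N → ℝ) (Δ : ℝ) : Prop :=
  ∀ G : SignedGraph N, 2 / 3 ≤ A.prob G {x | |x - f G| ≤ Δ}

end RandomizedQueryAlg

open Finset

namespace QueryTree

/-- Reading a fixed finite set of entries and post-processing them is a query algorithm. -/
theorem exists_of_local {N : ℕ} {α : Type} (Q : List (Fin N × Fin N))
    (f : (Fin N → Fin N → SignType) → α)
    (hf : ∀ s s', (∀ q ∈ Q, s q.1 q.2 = s' q.1 q.2) → f s = f s') :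
    ∃ T : QueryTree N α, T.depth ≤ Q.length ∧ ∀ G : SignedGraph N, T.run G = f G.sign := by
  induction Q generalizing f with
  | nil =>
    exact ⟨output (f fun _ _ => 0), by simp [depth], fun G => hf _ _ (by simp)⟩
  | cons q Q ih =>
    have key : ∀ σ : SignType, ∃ T : QueryTree N α, T.depth ≤ Q.length ∧
        ∀ G : SignedGraph N, T.run G =
          f fun u v => if (u, v) = q then σ else G.sign u v := by
      intro σ
      refine ih (fun s => f fun u v => if (u, v) = q then σ else s u v) fun s s' h => hf _ _ ?_
      intro p hp
      by_cases hpq : p = q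
      · simp [hpq]
      · simpa [hpq] using h p (by simpa [hpq] using hp)
    choose T hT hrun using key
    refine ⟨query q.1 q.2 T, ?_, fun G => ?_⟩
    · simpa [depth] using hT
    · rw [run, hrun]
      congr 1
      funext u v
      split_ifs with h
      · rw [← h]
      · rfl

end QueryTree

namespace RandomizedQueryAlg

/-- A random choice of a fixed finite set of entries, with post-processing, is a randomized query
algorithm, and its success probability is a ratio of counts. -/
theorem exists_of_local {N : ℕ} {α Ω : Type} [Fintype Ω] [Nonempty Ω] (B : ℕ)
    (Q : Ω → Finset (Fin N × Fin N)) (hQ : ∀ ω, (Q ω).card ≤ B)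
    (F : Ω → (Fin N → Fin N → SignType) → α)
    (hF : ∀ ω s s', (∀ q ∈ Q ω, s q.1 q.2 = s' q.1 q.2) → F ω s = F ω s') :
    ∃ A : RandomizedQueryAlg N α, A.QueriesAtMost B ∧
      ∀ (G : SignedGraph N) (S : Set α) [DecidablePred fun ω => F ω G.sign ∈ S],
        2 / 3 * (Fintype.card Ω : ℝ) ≤ (univ.filter fun ω => F ω G.sign ∈ S).card →
        2 / 3 ≤ A.prob G S := by
  have key : ∀ ω, ∃ T : QueryTree N α, T.depth ≤ B ∧
      ∀ G : SignedGraph N, T.run G = F ω G.sign := by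
    intro ω
    obtain ⟨T, hT, hr⟩ := QueryTree.exists_of_local (Q ω).toList (F ω)
      (fun s s' h => hF ω s s' fun q hq => h q (by simpa using hq))
    exact ⟨T, hT.trans (by simpa using hQ ω), hr⟩
  choose T hT hrun using key
  refine ⟨PMF.map T (PMF.uniformOfFintype Ω), ?_, ?_⟩
  · intro t ht
    obtain ⟨ω, -, rfl⟩ := (PMF.mem_support_map_iff _ _ _).1 ht
    exact_mod_cast hT ω
  · intro G S _ h
    classical
    have hpos : (0 : ℝ) < Fintype.card Ω := by exact_mod_cast Fintype.card_pos
    rw [prob, PMF.map_comp, PMF.toOuterMeasure_map_apply,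
      PMF.toOuterMeasure_uniformOfFintype_apply]
    have hset : (QueryTree.run G ∘ T) ⁻¹' S = {ω | F ω G.sign ∈ S} := by
      ext ω; simp [hrun]
    rw [Fintype.card_of_subtype (univ.filter fun ω => F ω G.sign ∈ S)
      (by intro ω; simp [hrun])]
    have h1 : (2 / 3 : ℝ) ≤ (univ.filter fun ω => F ω G.sign ∈ S).card / Fintype.card Ω := by
      rwa [le_div_iff₀ hpos]
    have h2 := ENNReal.ofReal_le_ofReal h1
    rw [ENNReal.ofReal_div_of_pos hpos, ENNReal.ofReal_natCast, ENNReal.ofReal_natCast,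
      ENNReal.ofReal_div_of_pos (by norm_num)] at h2
    simpa using h2

end RandomizedQueryAlg

section FiniteAverages

variable {T : Type*} [Fintype T]

theorem sum_fin_succ_fun {n : ℕ} (F : (Fin (n + 1) → T) → ℝ) :
    ∑ ω, F ω = ∑ ω : Fin n → T, ∑ b, F (Fin.snoc (α := fun _ => T) ω b) := by
  rw [← (Fin.snocEquiv fun _ : Fin (n + 1) => T).sum_comp, Fintype.sum_prod_type, sum_comm]
  rfl

/-- The second moment of a sum of independent centred samples. -/
theorem sum_sq_sum_of_sum_eq_zero (f : T → ℝ) (hf : ∑ b, f b = 0) (t : ℕ) :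
    (Fintype.card T : ℝ) * ∑ ω : Fin t → T, (∑ a, f (ω a)) ^ 2 =
      t * (Fintype.card T : ℝ) ^ t * ∑ b, f b ^ 2 := by
  induction t with
  | zero => simp
  | succ t ih =>
    have h : ∀ ω : Fin t → T, ∑ b, (∑ a, f (Fin.snoc (α := fun _ => T) ω b a)) ^ 2 =
        Fintype.card T * (∑ a, f (ω a)) ^ 2 + ∑ b, f b ^ 2 := by
      intro ω
      simp_rw [Fin.sum_univ_castSucc, Fin.snoc_castSucc, Fin.snoc_last, add_sq, sum_add_distrib,
        ← mul_sum, hf]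
      simp
    rw [sum_fin_succ_fun]
    simp_rw [h, sum_add_distrib, ← mul_sum]
    rw [ih]
    simp only [sum_const, card_univ, Fintype.card_fun, Fintype.card_fin, nsmul_eq_mul]
    push_cast
    ring

/-- Hoeffding's inequality for uniform independent samples from a finite type. -/
theorem card_sum_ge_le [Nonempty T] (f : T → ℝ) (hf : ∑ b, f b = 0) (h1 : ∀ b, |f b| ≤ 1)
    (m : ℕ) {δ : ℝ} (hδ : 0 ≤ δ) :
    ((univ.filter fun ω : Fin m → T => m * δ ≤ ∑ a, f (ω a)).card : ℝ) ≤
      (Fintype.card T : ℝ) ^ m * Real.exp (-(m * δ ^ 2 / 2)) := by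
  have hexp : ∀ b, Real.exp (δ * f b) ≤ Real.cosh δ + f b * Real.sinh δ := by
    intro b
    obtain ⟨hl, hu⟩ := abs_le.1 (h1 b)
    have hc := convexOn_exp.2 (Set.mem_univ δ) (Set.mem_univ (-δ))
      (show 0 ≤ (1 + f b) / 2 by linarith) (show 0 ≤ (1 - f b) / 2 by linarith) (by ring)
    simp only [smul_eq_mul] at hc
    rw [show (1 + f b) / 2 * δ + (1 - f b) / 2 * -δ = δ * f b by ring] at hc
    rw [Real.cosh_eq, Real.sinh_eq]
    linarith
  have hsum : ∑ b, Real.exp (δ * f b) ≤ Fintype.card T * Real.exp (δ ^ 2 / 2) := by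
    calc ∑ b, Real.exp (δ * f b) ≤ ∑ b, (Real.cosh δ + f b * Real.sinh δ) :=
          sum_le_sum fun b _ => hexp b
      _ = Fintype.card T * Real.cosh δ := by
          rw [sum_add_distrib, ← sum_mul, hf]; simp
      _ ≤ _ := by gcongr; exact Real.cosh_le_exp_half_sq δ
  have hmgf : ∑ ω : Fin m → T, Real.exp (δ * ∑ a, f (ω a)) ≤
      (Fintype.card T * Real.exp (δ ^ 2 / 2)) ^ m := by
    calc ∑ ω : Fin m → T, Real.exp (δ * ∑ a, f (ω a))
        = (∑ b, Real.exp (δ * f b)) ^ m := by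
          rw [Fintype.sum_pow]
          exact sum_congr rfl fun ω _ => by rw [mul_sum, Real.exp_sum]
      _ ≤ _ := by gcongr
  have hmarkov : ((univ.filter fun ω : Fin m → T => m * δ ≤ ∑ a, f (ω a)).card : ℝ) *
      Real.exp (m * δ ^ 2) ≤ ∑ ω : Fin m → T, Real.exp (δ * ∑ a, f (ω a)) := by
    rw [← nsmul_eq_mul, ← sum_const]
    refine (sum_le_sum fun ω hω => ?_).trans
      (sum_le_sum_of_subset_of_nonneg (filter_subset _ _) fun ω _ _ => (Real.exp_pos _).le)
    have := (mem_filter.1 hω).2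
    exact Real.exp_le_exp.2 (by nlinarith)
  rw [← le_div_iff₀ (Real.exp_pos _)] at hmarkov
  refine hmarkov.trans ((div_le_div_of_nonneg_right hmgf (Real.exp_pos _).le).trans_eq ?_)
  rw [mul_pow, ← Real.exp_nat_mul, mul_div_assoc, ← Real.exp_sub]
  congr 2
  ring

theorem card_abs_sum_ge_le [Nonempty T] (f : T → ℝ) (hf : ∑ b, f b = 0) (h1 : ∀ b, |f b| ≤ 1)
    (m : ℕ) {δ : ℝ} (hδ : 0 ≤ δ) :
    ((univ.filter fun ω : Fin m → T => m * δ ≤ |∑ a, f (ω a)|).card : ℝ) ≤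
      2 * ((Fintype.card T : ℝ) ^ m * Real.exp (-(m * δ ^ 2 / 2))) := by
  classical
  have hp := card_sum_ge_le f hf h1 m hδ
  have hn := card_sum_ge_le (fun b => -f b) (by simp [hf]) (by simpa using h1) m hδ
  have hsub : (univ.filter fun ω : Fin m → T => m * δ ≤ |∑ a, f (ω a)|) ⊆
      (univ.filter fun ω : Fin m → T => m * δ ≤ ∑ a, f (ω a)) ∪
        (univ.filter fun ω : Fin m → T => m * δ ≤ ∑ a, -f (ω a)) := by
    intro ω hω
    simpa [sum_neg_distrib, le_abs] using hω
  have hc : ((univ.filter fun ω : Fin m → T => m * δ ≤ |∑ a, f (ω a)|).card : ℝ) ≤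
      (univ.filter fun ω : Fin m → T => m * δ ≤ ∑ a, f (ω a)).card +
        (univ.filter fun ω : Fin m → T => m * δ ≤ ∑ a, -f (ω a)).card := by
    exact_mod_cast (card_le_card hsub).trans (card_union_le _ _)
  linarith

/-- Running `n` randomized steps, the `i`-th driven by the `i`-th random choice. -/
def iterateSteps {X : Type*} (step : ℕ → T → X → X) (x : X) : (n : ℕ) → (Fin n → T) → X
  | 0, _ => x
  | n + 1, U => step n (U (Fin.last n)) (iterateSteps step x n (Fin.init U))

/-- If every step increases `c` by at most `δ i` on average, then `n` steps increase it by at most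
`∑ i < n, δ i` on average. -/
theorem sum_iterateSteps_le {X : Type*} (step : ℕ → T → X → X) (c : X → ℝ) (δ : ℕ → ℝ)
    (h : ∀ i x, ∑ τ, c (step i τ x) ≤ Fintype.card T * (c x + δ i)) (x : X) (n : ℕ) :
    ∑ U, c (iterateSteps step x n U) ≤
      (Fintype.card T : ℝ) ^ n * (c x + ∑ i ∈ range n, δ i) := by
  induction n with
  | zero => simp [iterateSteps]
  | succ n ih =>
    rw [sum_fin_succ_fun]
    simp only [iterateSteps, Fin.snoc_last, Fin.init_snoc]
    refine (sum_le_sum fun U _ => h n _).trans ?_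
    rw [← mul_sum, sum_add_distrib, sum_range_succ, pow_succ']
    simp only [sum_const, card_univ, Fintype.card_fun, Fintype.card_fin, nsmul_eq_mul]
    push_cast
    nlinarith [mul_le_mul_of_nonneg_left ih (Nat.cast_nonneg (α := ℝ) (Fintype.card T))]

/-- Some colouring with `k` colours merges at most a `1 / k` fraction of the weight carried by the
pairs with distinct classes. -/
theorem exists_coloring {V W : Type*} [Fintype V] [Fintype W] [DecidableEq W] (k : ℕ) [NeZero k]
    (x : V → W) (w : V → V → ℝ) (hw : ∀ u v, w u v ≤ 1) :
    ∃ h : W → Fin k, ∑ u, ∑ v, (if x u ≠ x v ∧ h (x u) = h (x v) then w u v else 0) ≤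
      (Fintype.card V : ℝ) ^ 2 / k := by
  by_contra! hcon
  have hk : (0 : ℝ) < k := by exact_mod_cast Nat.pos_of_ne_zero (NeZero.ne k)
  have hlt := sum_lt_sum_of_nonempty (univ_nonempty (α := W → Fin k)) fun h _ => hcon h
  have hpair : ∀ a b : W, a ≠ b →
      (k : ℝ) * (univ.filter fun h : W → Fin k => h a = h b).card = (k : ℝ) ^ Fintype.card W := by
    intro a b hab
    have : ∀ j : Fin k, (univ.filter fun h : W → Fin k => h b = h a + j).card =
        (univ.filter fun h : W → Fin k => h a = h b).card := by
      intro j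
      refine card_bij' (fun h _ => Function.update h a (h a + j))
        (fun h _ => Function.update h a (h a - j)) ?_ ?_ ?_ ?_
      · intro h hh; simp_all [hab.symm]
      · intro h hh; simp_all [hab.symm]
      · intro h hh; simp
      · intro h hh; simp
    have hsum : ∑ j : Fin k, (univ.filter fun h : W → Fin k => h b = h a + j).card =
        Fintype.card (W → Fin k) := by
      rw [← card_univ, card_eq_sum_card_fiberwise (f := fun h : W → Fin k => h b - h a)
        (t := univ) (by simp)]
      refine sum_congr rfl fun j _ => ?_
      congr 1
      ext h
      simp [sub_eq_iff_eq_add']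
    simp only [this, sum_const, card_univ, Fintype.card_fin, smul_eq_mul, Fintype.card_fun] at hsum
    exact_mod_cast hsum
  have hle : ∑ h : W → Fin k,
      ∑ u, ∑ v, (if x u ≠ x v ∧ h (x u) = h (x v) then w u v else 0) ≤
      ∑ _u : V, ∑ _v : V, (k : ℝ) ^ Fintype.card W / k := by
    rw [sum_comm]
    refine sum_le_sum fun u _ => ?_
    rw [sum_comm]
    refine sum_le_sum fun v _ => ?_
    by_cases huv : x u = x v
    · simp only [huv, ne_eq, not_true_eq_false, false_and, if_false, sum_const_zero]
      positivity
    · simp only [ne_eq, huv, not_false_eq_true, true_and]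
      rw [← sum_filter, sum_const, nsmul_eq_mul, ← hpair _ _ huv, mul_div_cancel_left₀ _ hk.ne']
      exact mul_le_of_le_one_right (Nat.cast_nonneg _) (hw u v)
  simp only [sum_const, card_univ, Fintype.card_fun, Fintype.card_fin, nsmul_eq_mul] at hlt hle
  push_cast at hlt
  have : (Fintype.card V : ℝ) * (Fintype.card V * ((k : ℝ) ^ Fintype.card W / k)) =
    (k : ℝ) ^ Fintype.card W * ((Fintype.card V : ℝ) ^ 2 / k) := by ring
  linarith

end FiniteAverages

namespace SignedGraph

variable {N : ℕ}

/-- `1` if an entry `σ` violates a clustering in which its two nodes are (`same`) or are not in the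
same cluster, and `0` otherwise. -/
def disagree (σ : SignType) (same : Prop) [Decidable same] : ℝ :=
  (if σ = 1 then 1 else 0) - (if same then (σ : ℝ) else 0)

theorem disagree_eq_ite (σ : SignType) (same : Prop) [Decidable same] :
    disagree σ same = if (σ = 1 ∧ ¬ same) ∨ (σ = -1 ∧ same) then 1 else 0 := by
  unfold disagree
  by_cases h : same <;> rcases σ with _ | _ | _ <;> simp [h]

theorem disagree_mem_Icc (σ : SignType) (same : Prop) [Decidable same] :
    disagree σ same ∈ Set.Icc (0 : ℝ) 1 := by
  rw [disagree_eq_ite]; split_ifs <;> simp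

/-- The number of ordered pairs violating the clustering given by the labelling `x`. -/
def cost {κ : Type*} [DecidableEq κ] (s : Fin N → Fin N → SignType) (x : Fin N → κ) : ℝ :=
  ∑ u, ∑ v, disagree (s u v) (x u = x v)

theorem two_mul_card_filter_lt (r : Fin N → Fin N → Prop) [∀ u v, Decidable (r u v)]
    (hs : ∀ u v, r u v ↔ r v u) (hr : ∀ u, ¬ r u u) :
    2 * ((univ.filter fun p : Fin N × Fin N => p.1 < p.2 ∧ r p.1 p.2).card : ℝ) =
      ∑ u, ∑ v, if r u v then 1 else 0 := by
  have h1 : ∀ u v, (if r u v then (1 : ℝ) else 0) =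
      (if u < v ∧ r u v then 1 else 0) + (if v < u ∧ r v u then 1 else 0) := by
    intro u v
    rcases lt_trichotomy u v with h | h | h
    · simp [h, h.le]
    · subst h; simp [hr]
    · simp [h, h.le, hs u v]
  simp_rw [h1, sum_add_distrib]
  rw [sum_comm (f := fun u v => if v < u ∧ r v u then (1 : ℝ) else 0), ← two_mul,
    card_filter, Fintype.sum_prod_type]
  push_cast
  rfl

theorem two_mul_editDist (G H : SignedGraph N) :
    2 * (editDist G H : ℝ) = ∑ u, ∑ v, if G.sign u v ≠ H.sign u v then 1 else 0 :=
  two_mul_card_filter_lt (fun u v => G.sign u v ≠ H.sign u v)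
    (fun u v => by rw [G.symm, H.symm]) (fun u => by simp [G.loopless, H.loopless])

theorem exists_weakFrustrationIndex_eq (G : SignedGraph N) :
    ∃ H : SignedGraph N, H.IsDeletionOf G ∧ H.IsClusterable ∧
      editDist G H = G.weakFrustrationIndex :=
  Nat.sInf_mem (s := {m | ∃ H : SignedGraph N, H.IsDeletionOf G ∧ H.IsClusterable ∧
    editDist G H = m})
    ⟨_, ⟨fun _ _ => 0, fun _ _ => rfl, fun _ => rfl⟩, fun _ _ => Or.inr rfl,
      ⟨⊤, fun _ _ => by simp⟩, rfl⟩

theorem two_mul_weakFrustrationIndex_le_cost {κ : Type*} [DecidableEq κ] (G : SignedGraph N)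
    (x : Fin N → κ) : 2 * (G.weakFrustrationIndex : ℝ) ≤ cost G.sign x := by
  let bad : Fin N → Fin N → Prop := fun u v =>
    (G.sign u v = 1 ∧ ¬ x u = x v) ∨ (G.sign u v = -1 ∧ x u = x v)
  have hsymm : ∀ u v, bad u v ↔ bad v u := fun u v => by
    simp only [bad, G.symm u v, eq_comm (a := x u)]
  let H : SignedGraph N :=
    { sign := fun u v => if bad u v then 0 else G.sign u v
      symm := fun u v => by simp only [hsymm u v, G.symm u v]
      loopless := fun v => by simp [G.loopless] }
  have hcost : cost G.sign x = 2 * (editDist G H : ℝ) := by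
    rw [two_mul_editDist]
    refine sum_congr rfl fun u _ => sum_congr rfl fun v _ => ?_
    rw [disagree_eq_ite]
    refine if_congr ?_ rfl rfl
    change bad u v ↔ G.sign u v ≠ if bad u v then 0 else G.sign u v
    by_cases hb : bad u v
    · simp only [hb, if_true, true_iff]
      rcases hb with hb | hb <;> rw [hb.1] <;> decide
    · simp [hb]
  rw [hcost]
  have : G.weakFrustrationIndex ≤ editDist G H := by
    refine Nat.sInf_le ⟨H, fun u v => ?_, ⟨Setoid.ker x, fun u v => ?_⟩, rfl⟩
    · change (if bad u v then 0 else G.sign u v) = _ ∨ (if bad u v then 0 else G.sign u v) = 0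
      split_ifs <;> simp
    · change ((if bad u v then 0 else G.sign u v) = 1 → x u = x v) ∧
        ((if bad u v then 0 else G.sign u v) = -1 → ¬ x u = x v)
      by_cases hb : bad u v
      · simp only [hb, if_true]
        exact ⟨fun h => absurd h (by decide), fun h => absurd h (by decide)⟩
      · simp only [hb, if_false]
        simp only [bad] at hb
        tauto
  have h2 : (G.weakFrustrationIndex : ℝ) ≤ editDist G H := by exact_mod_cast this
  linarith

theorem IsClusterable.exists_cost_le {H : SignedGraph N} (hH : H.IsClusterable)
    (G : SignedGraph N) : ∃ x : Fin N → Fin N, cost G.sign x ≤ 2 * (editDist G H : ℝ) := by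
  obtain ⟨P, hP⟩ := hH
  refine ⟨fun v => (Quotient.mk P v).out, ?_⟩
  rw [two_mul_editDist]
  refine sum_le_sum fun u _ => sum_le_sum fun v _ => ?_
  have hx : ((Quotient.mk P u).out = (Quotient.mk P v).out) ↔ P u v := by
    rw [Quotient.out_inj, Quotient.eq]
  by_cases h : G.sign u v = H.sign u v
  · have := hP u v
    rw [disagree_eq_ite, if_neg]
    · simp [h]
    · rw [hx, h]; tauto
  · simpa [h] using (disagree_mem_Icc _ _).2

theorem IsClusterable.weakFrustrationIndex_le {H : SignedGraph N} (hH : H.IsClusterable)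
    (G : SignedGraph N) : (G.weakFrustrationIndex : ℝ) ≤ editDist G H := by
  obtain ⟨x, hx⟩ := hH.exists_cost_le G
  linarith [G.two_mul_weakFrustrationIndex_le_cost x]

/-- Few labels suffice. -/
theorem exists_cost_le_of_labels (G : SignedGraph N) (k : ℕ) [NeZero k] :
    ∃ x : Fin N → Fin k, cost G.sign x ≤ 2 * (G.weakFrustrationIndex : ℝ) + (N : ℝ) ^ 2 / k := by
  obtain ⟨H, -, hH, hHG⟩ := G.exists_weakFrustrationIndex_eq
  obtain ⟨x, hx⟩ := hH.exists_cost_le G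
  obtain ⟨h, hh⟩ := exists_coloring k x (fun u v => -((G.sign u v : SignType) : ℝ))
    (fun u v => by rcases G.sign u v with _ | _ | _ <;> simp)
  refine ⟨h ∘ x, ?_⟩
  have : cost G.sign (h ∘ x) = cost G.sign x + ∑ u, ∑ v,
      (if x u ≠ x v ∧ h (x u) = h (x v) then -((G.sign u v : SignType) : ℝ) else 0) := by
    simp only [cost, ← sum_add_distrib]
    refine sum_congr rfl fun u _ => sum_congr rfl fun v _ => ?_
    unfold disagree
    by_cases h1 : x u = x v
    · simp [h1]
    · by_cases h2 : h (x u) = h (x v) <;> simp [h1, h2]; ring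
  rw [this, ← hHG]
  simp only [Fintype.card_fin] at hh
  linarith

/-! ### Greedy relabelling -/

/-- A maximizer of a function on a finite nonempty set of labels. -/
noncomputable def argmaxLabel {k : ℕ} [NeZero k] (φ : Fin k → ℝ) : Fin k :=
  Classical.choose (Finite.exists_max φ)

theorem le_argmaxLabel {k : ℕ} [NeZero k] (φ : Fin k → ℝ) (j : Fin k) :
    φ j ≤ φ (argmaxLabel φ) :=
  Classical.choose_spec (Finite.exists_max φ) j

/-- The label preferred by `u` according to the training nodes `τ` with labels `μ`. -/
noncomputable def greedyLabel {k t : ℕ} [NeZero k] (s : Fin N → Fin N → SignType)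
    (τ : Fin t → Fin N) (μ : Fin t → Fin k) (u : Fin N) : Fin k :=
  argmaxLabel fun j => ∑ a, if μ a = j then ((s u (τ a) : SignType) : ℝ) else 0

/-- Relabel the nodes of the part `i` greedily. -/
noncomputable def greedyStep {k t ℓ : ℕ} [NeZero k] (s : Fin N → Fin N → SignType)
    (p : Fin N → Fin ℓ) (i : ℕ) (τ : Fin t → Fin N) (y : Fin N → Fin k) : Fin N → Fin k :=
  fun u => if (p u : ℕ) = i then greedyLabel s τ (y ∘ τ) u else y u

/-- The labelling obtained from labels `lab` of the training nodes `U`. -/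
noncomputable def decode {k t ℓ : ℕ} [NeZero k] (s : Fin N → Fin N → SignType)
    (p : Fin N → Fin ℓ) (U : Fin ℓ → Fin t → Fin N) (lab : Fin ℓ → Fin t → Fin k) :
    Fin N → Fin k :=
  fun u => greedyLabel s (U (p u)) (lab (p u)) u

theorem iterateSteps_greedyStep {k t ℓ : ℕ} [NeZero k] (s : Fin N → Fin N → SignType)
    (p : Fin N → Fin ℓ) (x : Fin N → Fin k) (n : ℕ) (U : Fin n → Fin t → Fin N) :
    ∃ lab : Fin n → Fin t → Fin k, ∀ u (h : (p u : ℕ) < n),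
      iterateSteps (greedyStep s p) x n U u = greedyLabel s (U ⟨p u, h⟩) (lab ⟨p u, h⟩) u := by
  induction n with
  | zero => exact ⟨fun i => i.elim0, fun u h => absurd h (Nat.not_lt_zero _)⟩
  | succ n ih =>
    obtain ⟨lab, hlab⟩ := ih (Fin.init U)
    refine ⟨Fin.snoc (α := fun _ => Fin t → Fin k) lab
      (iterateSteps (greedyStep s p) x n (Fin.init U) ∘ U (Fin.last n)), fun u h => ?_⟩
    rw [iterateSteps, greedyStep]
    by_cases hu : (p u : ℕ) = n
    · rw [if_pos hu]
      have : (⟨p u, h⟩ : Fin (n + 1)) = Fin.last n := Fin.ext hu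
      rw [this, Fin.snoc_last]
    · have hlt : (p u : ℕ) < n := by omega
      rw [if_neg hu, hlab u hlt]
      have : (⟨p u, h⟩ : Fin (n + 1)) = Fin.castSucc ⟨p u, hlt⟩ := rfl
      rw [this, Fin.snoc_castSucc]
      rfl

theorem exists_decode_eq_iterateSteps {k t ℓ : ℕ} [NeZero k] (s : Fin N → Fin N → SignType)
    (p : Fin N → Fin ℓ) (x : Fin N → Fin k) (U : Fin ℓ → Fin t → Fin N) :
    ∃ lab, decode s p U lab = iterateSteps (greedyStep s p) x ℓ U := by
  obtain ⟨lab, h⟩ := iterateSteps_greedyStep s p x ℓ U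
  exact ⟨lab, funext fun u => (h u (p u).2).symm⟩

/-- The total sign of the edges from `u` to the nodes labelled `j`. -/
def attraction {k : ℕ} (s : Fin N → Fin N → SignType) (y : Fin N → Fin k) (u : Fin N)
    (j : Fin k) : ℝ :=
  ∑ v, if y v = j then ((s u v : SignType) : ℝ) else 0

/-- The cost of relabelling a part, compared with its first-order approximation. -/
theorem cost_relabel_le {k : ℕ} (G : SignedGraph N) (S : Finset (Fin N)) (y y' : Fin N → Fin k)
    (h : ∀ u ∉ S, y' u = y u) :
    cost G.sign y' ≤ cost G.sign y +
      2 * ∑ u ∈ S, (attraction G.sign y u (y u) - attraction G.sign y u (y' u)) +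
      2 * ∑ u ∈ S, ∑ v ∈ S, (if u ≠ v then 1 else 0) := by
  let d : Fin N → Fin N → ℝ := fun u v => if u ∈ S then
    (if y v = y u then ((G.sign u v : SignType) : ℝ) else 0) -
      (if y v = y' u then ((G.sign u v : SignType) : ℝ) else 0) else 0
  have hd : ∑ u ∈ S, (attraction G.sign y u (y u) - attraction G.sign y u (y' u)) =
      ∑ u, ∑ v, d u v := by
    simp only [d, attraction, ← sum_sub_distrib, sum_ite_irrel, sum_const_zero, sum_ite_mem,
      univ_inter]
  have hd2 : 2 * ∑ u, ∑ v, d u v = ∑ u, ∑ v, (d u v + d v u) := by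
    simp_rw [sum_add_distrib]
    rw [sum_comm (f := fun u v => d v u), two_mul]
  have hq : ∑ u ∈ S, ∑ v ∈ S, (if u ≠ v then (1 : ℝ) else 0) =
      ∑ u, ∑ v, if u ∈ S ∧ v ∈ S ∧ u ≠ v then (1 : ℝ) else 0 := by
    simp only [ite_and, sum_ite_irrel, sum_const_zero, sum_ite_mem, univ_inter]
  rw [hd, hd2, hq, mul_sum, cost, cost, ← sum_add_distrib, ← sum_add_distrib]
  refine sum_le_sum fun u _ => ?_
  rw [mul_sum, ← sum_add_distrib, ← sum_add_distrib]
  refine sum_le_sum fun v _ => ?_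
  simp only [d, disagree, G.symm v u]
  by_cases huv : u = v
  · subst huv; simp [G.loopless]
  by_cases hu : u ∈ S <;> by_cases hv : v ∈ S
  · simp only [hu, hv, huv, ne_eq, not_false_eq_true, and_self, if_true, eq_comm (a := y v)]
    rcases G.sign u v with _ | _ | _ <;> simp <;> split_ifs <;> norm_num
  · simp only [hu, hv, h v hv, eq_comm (a := y v), if_true, if_false, false_and, and_false]
    linarith
  · simp only [hu, hv, h u hu, eq_comm (a := y v), if_true, if_false, false_and]
    linarith
  · simp [hu, hv, h u hu, h v hv]

end SignedGraph

namespace SignedGraph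

variable {N : ℕ}

/-- The average loss of a node relabelled greedily according to a random training set. -/
theorem sum_attraction_sub_le {k r : ℕ} [NeZero k] [NeZero N] (hr : 0 < r)
    (s : Fin N → Fin N → SignType) (y : Fin N → Fin k) (u : Fin N) :
    ∑ τ : Fin (r ^ 2) → Fin N,
        (attraction s y u (y u) - attraction s y u (greedyLabel s τ (y ∘ τ) u)) ≤
      (N : ℝ) ^ (r ^ 2) * (2 * N / r) := by
  have hN : (0 : ℝ) < N := by exact_mod_cast Nat.pos_of_ne_zero (NeZero.ne N)
  have hr' : (0 : ℝ) < r := by exact_mod_cast hr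
  let φ : Fin k → Fin N → ℝ := fun j v =>
    (if y v = j then ((s u v : SignType) : ℝ) else 0) - attraction s y u j / N
  let Q : (Fin (r ^ 2) → Fin N) → ℝ := fun τ => ∑ j, (∑ a, φ j (τ a)) ^ 2
  have hφ : ∀ j, ∑ v, φ j v = 0 := fun j => by
    simp only [φ, sum_sub_distrib, sum_const, card_univ, Fintype.card_fin, nsmul_eq_mul]
    rw [mul_div_cancel₀ _ hN.ne', attraction, sub_self]
  have hφ2 : ∑ j, ∑ v, φ j v ^ 2 ≤ N := by
    have h1 : ∀ j, ∑ v, φ j v ^ 2 ≤ ∑ v, if y v = j then (1 : ℝ) else 0 := by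
      intro j
      have h2 : ∑ v, φ j v ^ 2 + N * (attraction s y u j / N) ^ 2 =
          ∑ v, (if y v = j then ((s u v : SignType) : ℝ) else 0) ^ 2 := by
        have h3 : ∀ v, (if y v = j then ((s u v : SignType) : ℝ) else 0) ^ 2 =
            φ j v ^ 2 + 2 * (attraction s y u j / N) * φ j v + (attraction s y u j / N) ^ 2 :=
          fun v => by simp only [φ]; ring
        simp_rw [h3, sum_add_distrib, ← mul_sum, hφ]
        simp
      have h4 : ∑ v, (if y v = j then ((s u v : SignType) : ℝ) else 0) ^ 2 ≤
          ∑ v, if y v = j then (1 : ℝ) else 0 := by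
        refine sum_le_sum fun v _ => ?_
        split_ifs
        · rcases s u v with _ | _ | _ <;> simp
        · simp
      have h5 : 0 ≤ N * (attraction s y u j / N) ^ 2 := by positivity
      linarith
    refine (sum_le_sum fun j _ => h1 j).trans_eq ?_
    rw [sum_comm]
    simp
  have hQ : ∑ τ, Q τ ≤ (r : ℝ) ^ 2 * (N : ℝ) ^ (r ^ 2) := by
    have h1 : (N : ℝ) * ∑ τ, Q τ = (r : ℝ) ^ 2 * (N : ℝ) ^ (r ^ 2) * ∑ j, ∑ v, φ j v ^ 2 := by
      simp only [Q]
      rw [sum_comm, mul_sum, mul_sum]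
      refine sum_congr rfl fun j _ => ?_
      have := sum_sq_sum_of_sum_eq_zero (φ j) (hφ j) (r ^ 2)
      simpa using this
    have h2 : (N : ℝ) * ∑ τ, Q τ ≤ N * ((r : ℝ) ^ 2 * (N : ℝ) ^ (r ^ 2)) := by
      rw [h1, mul_comm (N : ℝ)]
      gcongr
    exact le_of_mul_le_mul_left h2 hN
  have hpt : ∀ τ : Fin (r ^ 2) → Fin N,
      attraction s y u (y u) - attraction s y u (greedyLabel s τ (y ∘ τ) u) ≤
        N / (r : ℝ) ^ 2 * (Q τ / r + r) := by
    intro τ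
    set g := greedyLabel s τ (y ∘ τ) u with hg
    have hscore : ∀ j, (∑ a, if (y ∘ τ) a = j then ((s u (τ a) : SignType) : ℝ) else 0) =
        ∑ a, φ j (τ a) + (r : ℝ) ^ 2 * (attraction s y u j / N) := by
      intro j
      simp only [φ, sum_sub_distrib, sum_const, card_univ, Fintype.card_fin, nsmul_eq_mul,
        Function.comp_apply]
      push_cast
      ring
    have hmax := le_argmaxLabel
      (fun j => ∑ a, if (y ∘ τ) a = j then ((s u (τ a) : SignType) : ℝ) else 0) (y u)
    simp only [hscore] at hmax
    have hg' : (argmaxLabel fun j =>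
        ∑ a, φ j (τ a) + (r : ℝ) ^ 2 * (attraction s y u j / N)) = g := by
      rw [hg, greedyLabel]
      congr 1
      exact funext fun j => (hscore j).symm
    rw [hg'] at hmax
    have hle : ∀ j, |∑ a, φ j (τ a)| ≤ (∑ a, φ j (τ a)) ^ 2 / (2 * r) + r / 2 := by
      intro j
      rw [div_add_div _ _ (by positivity) (by norm_num), le_div_iff₀ (by positivity),
        ← sq_abs (∑ a, φ j (τ a))]
      nlinarith [sq_nonneg (|∑ a, φ j (τ a)| - r)]
    have hQj : ∀ j, (∑ a, φ j (τ a)) ^ 2 ≤ Q τ := fun j =>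
      single_le_sum (f := fun j => (∑ a, φ j (τ a)) ^ 2) (fun _ _ => sq_nonneg _) (mem_univ j)
    have hb : ∀ j, |∑ a, φ j (τ a)| ≤ Q τ / (2 * r) + r / 2 := fun j =>
      (hle j).trans (by gcongr; exact hQj j)
    have h1 := abs_le.1 (hb (y u))
    have h2 := abs_le.1 (hb g)
    have h3 : (r : ℝ) ^ 2 * ((attraction s y u (y u) - attraction s y u g) / N) ≤
        Q τ / r + r := by
      have : Q τ / r = 2 * (Q τ / (2 * r)) := by field_simp
      rw [this, sub_div]
      linarith [h1.1, h2.2]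
    rw [← mul_div_assoc, div_le_iff₀ hN] at h3
    rw [div_mul_eq_mul_div, le_div_iff₀ (by positivity)]
    linarith
  refine (sum_le_sum fun τ _ => hpt τ).trans ?_
  rw [← mul_sum, sum_add_distrib, ← sum_div]
  simp only [sum_const, card_univ, Fintype.card_fun, Fintype.card_fin, nsmul_eq_mul]
  push_cast
  calc N / (r : ℝ) ^ 2 * ((∑ τ, Q τ) / r + (N : ℝ) ^ (r ^ 2) * r)
      ≤ N / (r : ℝ) ^ 2 * (((r : ℝ) ^ 2 * (N : ℝ) ^ (r ^ 2)) / r + (N : ℝ) ^ (r ^ 2) * r) := by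
        gcongr
    _ = _ := by field_simp; ring

/-- The average effect of a greedy step on the cost. -/
theorem sum_cost_greedyStep_le {k r ℓ : ℕ} [NeZero k] [NeZero N] (hr : 0 < r)
    (G : SignedGraph N) (p : Fin N → Fin ℓ) (i : ℕ) (y : Fin N → Fin k) :
    ∑ τ : Fin (r ^ 2) → Fin N, cost G.sign (greedyStep G.sign p i τ y) ≤
      Fintype.card (Fin (r ^ 2) → Fin N) * (cost G.sign y +
        ∑ u, if (p u : ℕ) = i then
          (4 * N / r + 2 * ∑ v, if u ≠ v ∧ p u = p v then (1 : ℝ) else 0) else 0) := by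
  let S : Finset (Fin N) := univ.filter fun u => (p u : ℕ) = i
  have hpt : ∀ τ : Fin (r ^ 2) → Fin N, cost G.sign (greedyStep G.sign p i τ y) ≤
      cost G.sign y + 2 * ∑ u ∈ S, (attraction G.sign y u (y u) -
        attraction G.sign y u (greedyLabel G.sign τ (y ∘ τ) u)) +
      2 * ∑ u ∈ S, ∑ v, (if u ≠ v ∧ p u = p v then (1 : ℝ) else 0) := by
    intro τ
    have hin : ∀ u ∈ S, greedyStep G.sign p i τ y u = greedyLabel G.sign τ (y ∘ τ) u :=
      fun u hu => by rw [greedyStep, if_pos (by simpa [S] using hu)]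
    have hout : ∀ u ∉ S, greedyStep G.sign p i τ y u = y u :=
      fun u hu => by rw [greedyStep, if_neg (by simpa [S] using hu)]
    have h1 : ∑ u ∈ S, ∑ v ∈ S, (if u ≠ v then (1 : ℝ) else 0) =
        ∑ u ∈ S, ∑ v, if u ≠ v ∧ p u = p v then (1 : ℝ) else 0 := by
      refine sum_congr rfl fun u hu => ?_
      have hu' : (p u : ℕ) = i := by simpa [S] using hu
      rw [sum_filter]
      refine sum_congr rfl fun v _ => ?_
      rw [← ite_and]
      exact if_congr (by rw [and_comm, Fin.ext_iff (a := p u), hu', eq_comm (a := i)]) rfl rfl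
    have h2 : ∑ u ∈ S, (attraction G.sign y u (y u) -
        attraction G.sign y u (greedyStep G.sign p i τ y u)) =
        ∑ u ∈ S, (attraction G.sign y u (y u) -
          attraction G.sign y u (greedyLabel G.sign τ (y ∘ τ) u)) :=
      sum_congr rfl fun u hu => by rw [hin u hu]
    rw [← h1, ← h2]
    exact cost_relabel_le G S y _ hout
  refine (sum_le_sum fun τ _ => hpt τ).trans ?_
  have hsum : ∑ u ∈ S, ∑ τ : Fin (r ^ 2) → Fin N, (attraction G.sign y u (y u) -
      attraction G.sign y u (greedyLabel G.sign τ (y ∘ τ) u)) ≤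
      ∑ _u ∈ S, (N : ℝ) ^ (r ^ 2) * (2 * N / r) :=
    sum_le_sum fun u _ => sum_attraction_sub_le hr G.sign y u
  rw [sum_add_distrib, sum_add_distrib, ← mul_sum, sum_comm, ← sum_filter, sum_add_distrib,
    ← mul_sum (univ.filter fun u => (p u : ℕ) = i)]
  change _ ≤ _ * (_ + (∑ _u ∈ S, _ + 2 * ∑ u ∈ S, _))
  simp only [sum_const, card_univ, Fintype.card_fun, Fintype.card_fin, nsmul_eq_mul] at hsum ⊢
  push_cast
  have : (N : ℝ) ^ (r ^ 2) * (S.card * (4 * N / r)) =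
      2 * (S.card * ((N : ℝ) ^ (r ^ 2) * (2 * N / r))) := by ring
  rw [mul_add, mul_add, this]
  linarith

/-- Decoding suitable labels of random training nodes yields, on average, almost the least cost. -/
theorem sum_cost_iterateSteps_le {k r ℓ : ℕ} [NeZero k] [NeZero N] (hr : 0 < r)
    (G : SignedGraph N) (p : Fin N → Fin ℓ)
    (hp : ∑ u, ∑ v, (if u ≠ v ∧ p u = p v then (1 : ℝ) else 0) ≤ (N : ℝ) ^ 2 / ℓ)
    (x : Fin N → Fin k) :
    ∑ U : Fin ℓ → Fin (r ^ 2) → Fin N,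
        cost G.sign (iterateSteps (greedyStep G.sign p) x ℓ U) ≤
      Fintype.card (Fin ℓ → Fin (r ^ 2) → Fin N) *
        (cost G.sign x + (4 * (N : ℝ) ^ 2 / r + 2 * (N : ℝ) ^ 2 / ℓ)) := by
  refine (sum_iterateSteps_le (greedyStep G.sign p) (cost G.sign) _
    (fun i y => sum_cost_greedyStep_le hr G p i y) x ℓ).trans ?_
  have hcard : (Fintype.card (Fin ℓ → Fin (r ^ 2) → Fin N) : ℝ) =
      (Fintype.card (Fin (r ^ 2) → Fin N) : ℝ) ^ ℓ := by
    rw [Fintype.card_fun, Fintype.card_fin]; push_cast; rfl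
  rw [hcard]
  gcongr
  rw [sum_comm]
  have h : ∀ u, ∑ i ∈ range ℓ, (if (p u : ℕ) = i then
      (4 * (N : ℝ) / r + 2 * ∑ v, if u ≠ v ∧ p u = p v then (1 : ℝ) else 0) else 0) =
      4 * (N : ℝ) / r + 2 * ∑ v, if u ≠ v ∧ p u = p v then (1 : ℝ) else 0 := by
    intro u
    rw [sum_ite_eq, if_pos (mem_range.2 (p u).2)]
  simp_rw [h, sum_add_distrib, ← mul_sum]
  simp only [sum_const, card_univ, Fintype.card_fin, nsmul_eq_mul]
  have : (N : ℝ) * (4 * N / r) = 4 * (N : ℝ) ^ 2 / r := by ring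
  rw [this, mul_div_assoc 2]
  gcongr

/-- For most choices of the training nodes, some labels of them decode to a labelling of almost the
least cost. -/
theorem card_forall_decode_gt_le {k r ℓ : ℕ} [NeZero k] [NeZero N] (hr : 0 < r) (hℓ : 0 < ℓ)
    (G : SignedGraph N) (p : Fin N → Fin ℓ)
    (hp : ∑ u, ∑ v, (if u ≠ v ∧ p u = p v then (1 : ℝ) else 0) ≤ (N : ℝ) ^ 2 / ℓ)
    (x : Fin N → Fin k) (hx : ∀ y : Fin N → Fin k, cost G.sign x ≤ cost G.sign y)
    (b : ℝ) (hb : 6 * (4 * (N : ℝ) ^ 2 / r + 2 * (N : ℝ) ^ 2 / ℓ) ≤ b)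
    [DecidablePred fun U : Fin ℓ → Fin (r ^ 2) → Fin N =>
      ∀ lab : Fin ℓ → Fin (r ^ 2) → Fin k, cost G.sign x + b < cost G.sign (decode G.sign p U lab)] :
    6 * ((univ.filter fun U : Fin ℓ → Fin (r ^ 2) → Fin N =>
      ∀ lab : Fin ℓ → Fin (r ^ 2) → Fin k, cost G.sign x + b < cost G.sign (decode G.sign p U lab)).card : ℝ) ≤
      Fintype.card (Fin ℓ → Fin (r ^ 2) → Fin N) := by
  have hN : (0 : ℝ) < N := by exact_mod_cast Nat.pos_of_ne_zero (NeZero.ne N)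
  have hr' : (0 : ℝ) < r := by exact_mod_cast hr
  set B := 4 * (N : ℝ) ^ 2 / r + 2 * (N : ℝ) ^ 2 / ℓ with hB
  have hBpos : 0 < B := by positivity
  have hsum := sum_cost_iterateSteps_le hr G p hp x
  set bad := univ.filter fun U : Fin ℓ → Fin (r ^ 2) → Fin N =>
      ∀ lab : Fin ℓ → Fin (r ^ 2) → Fin k, cost G.sign x + b < cost G.sign (decode G.sign p U lab) with hbad
  have h1 : (bad.card : ℝ) * b ≤
      ∑ U : Fin ℓ → Fin (r ^ 2) → Fin N,
        (cost G.sign (iterateSteps (greedyStep G.sign p) x ℓ U) - cost G.sign x) := by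
    rw [← nsmul_eq_mul, ← sum_const]
    refine (sum_le_sum fun U hU => ?_).trans
      (sum_le_sum_of_subset_of_nonneg (filter_subset _ _) fun U _ _ => sub_nonneg.2 (hx _))
    obtain ⟨lab, hlab⟩ := exists_decode_eq_iterateSteps G.sign p x U
    have := (mem_filter.1 hU).2 lab
    rw [← hlab]
    linarith
  rw [sum_sub_distrib, sum_const, card_univ, nsmul_eq_mul] at h1
  have h2 : (bad.card : ℝ) * (6 * B) ≤ (bad.card : ℝ) * b := by gcongr
  refine le_of_mul_le_mul_right ?_ hBpos
  linarith

end SignedGraph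

namespace SignedGraph

variable {N : ℕ}

/-- The fraction of the sampled pairs `q` violating the labelling `x`. -/
noncomputable def sampleCost {κ : Type*} [DecidableEq κ] {m : ℕ} (s : Fin N → Fin N → SignType)
    (x : Fin N → κ) (q : Fin m → Fin N × Fin N) : ℝ :=
  (∑ a, disagree (s (q a).1 (q a).2) (x (q a).1 = x (q a).2)) / m

/-- The estimate of the weak frustration index from training nodes `U` and sampled pairs `q`. -/
noncomputable def estimate {t ℓ m : ℕ} (k : ℕ) [NeZero k] (p : Fin N → Fin ℓ)
    (ω : (Fin ℓ → Fin t → Fin N) × (Fin m → Fin N × Fin N)) (s : Fin N → Fin N → SignType) : ℝ :=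
  (N : ℝ) ^ 2 / 2 *
    ⨅ lab : Fin ℓ → Fin t → Fin k, sampleCost s (decode s p ω.1 lab) ω.2

/-- The entries read to compute the estimate. -/
def estimateQueries {t ℓ m : ℕ} (p : Fin N → Fin ℓ)
    (ω : (Fin ℓ → Fin t → Fin N) × (Fin m → Fin N × Fin N)) : Finset (Fin N × Fin N) :=
  univ.biUnion fun a => insert (ω.2 a)
    ((univ.image fun j => ((ω.2 a).1, ω.1 (p (ω.2 a).1) j)) ∪
      univ.image fun j => ((ω.2 a).2, ω.1 (p (ω.2 a).2) j))

theorem card_estimateQueries_le {t ℓ m : ℕ} (p : Fin N → Fin ℓ)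
    (ω : (Fin ℓ → Fin t → Fin N) × (Fin m → Fin N × Fin N)) :
    (estimateQueries p ω).card ≤ m * (2 * t + 1) := by
  refine (card_biUnion_le_card_mul _ _ (2 * t + 1) fun a _ => ?_).trans (by simp)
  refine (card_insert_le _ _).trans ?_
  gcongr
  refine (card_union_le _ _).trans ?_
  have h : ∀ f : Fin t → Fin N × Fin N, (univ.image f).card ≤ t := fun f =>
    card_image_le.trans (by simp)
  have := h fun j => ((ω.2 a).1, ω.1 (p (ω.2 a).1) j)
  have := h fun j => ((ω.2 a).2, ω.1 (p (ω.2 a).2) j)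
  omega

theorem estimate_congr {t ℓ m : ℕ} (k : ℕ) [NeZero k] (p : Fin N → Fin ℓ)
    (ω : (Fin ℓ → Fin t → Fin N) × (Fin m → Fin N × Fin N)) (s s' : Fin N → Fin N → SignType)
    (h : ∀ q ∈ estimateQueries p ω, s q.1 q.2 = s' q.1 q.2) :
    estimate k p ω s = estimate k p ω s' := by
  have hmem : ∀ a q, (q = ω.2 a ∨ (∃ j, ((ω.2 a).1, ω.1 (p (ω.2 a).1) j) = q) ∨
      ∃ j, ((ω.2 a).2, ω.1 (p (ω.2 a).2) j) = q) → q ∈ estimateQueries p ω := by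
    intro a q hq
    simp only [estimateQueries, mem_biUnion, mem_univ, true_and, mem_insert, mem_union, mem_image]
    exact ⟨a, hq⟩
  unfold estimate
  congr 2
  funext lab
  have hdec : ∀ u, (∀ j, s u (ω.1 (p u) j) = s' u (ω.1 (p u) j)) →
      decode s p ω.1 lab u = decode s' p ω.1 lab u := by
    intro u hu
    simp only [decode, greedyLabel, hu]
  unfold sampleCost
  congr 1
  refine sum_congr rfl fun a _ => ?_
  rw [h _ (hmem a _ (Or.inl rfl)),
    hdec _ fun j => h _ (hmem a _ (Or.inr (Or.inl ⟨j, rfl⟩))),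
    hdec _ fun j => h _ (hmem a _ (Or.inr (Or.inr ⟨j, rfl⟩)))]

/-- The sampled cost of a fixed labelling is accurate with high probability. -/
theorem card_sampleCost_inaccurate_le [NeZero N] {κ : Type*} [DecidableEq κ]
    (s : Fin N → Fin N → SignType) (x : Fin N → κ) {m : ℕ} (hm : 0 < m) {ε : ℝ} (hε : 0 ≤ ε) :
    ((univ.filter fun q : Fin m → Fin N × Fin N =>
      ε * (N : ℝ) ^ 2 ≤ |(N : ℝ) ^ 2 * sampleCost s x q - cost s x|).card : ℝ) ≤
      2 * ((Fintype.card (Fin m → Fin N × Fin N) : ℝ) * Real.exp (-(m * ε ^ 2 / 2))) := by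
  have hN : (0 : ℝ) < N := by exact_mod_cast Nat.pos_of_ne_zero (NeZero.ne N)
  have hm' : (0 : ℝ) < m := by exact_mod_cast hm
  have : Nonempty (Fin N × Fin N) := ⟨(0, 0)⟩
  let f : Fin N × Fin N → ℝ := fun b =>
    disagree (s b.1 b.2) (x b.1 = x b.2) - cost s x / (N : ℝ) ^ 2
  have hcost : ∑ b : Fin N × Fin N, disagree (s b.1 b.2) (x b.1 = x b.2) = cost s x := by
    rw [Fintype.sum_prod_type]; rfl
  have hf : ∑ b, f b = 0 := by
    simp only [f, sum_sub_distrib, hcost, sum_const, card_univ, Fintype.card_prod,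
      Fintype.card_fin, nsmul_eq_mul]
    push_cast
    field_simp
    ring
  have hcost_nonneg : 0 ≤ cost s x :=
    sum_nonneg fun u _ => sum_nonneg fun v _ => (disagree_mem_Icc _ _).1
  have hcost_le : cost s x ≤ (N : ℝ) ^ 2 := by
    calc cost s x ≤ ∑ _u : Fin N, ∑ _v : Fin N, (1 : ℝ) :=
          sum_le_sum fun u _ => sum_le_sum fun v _ => (disagree_mem_Icc _ _).2
      _ = _ := by simp [sq]
  have h1 : ∀ b, |f b| ≤ 1 := by
    intro b
    have hb := disagree_mem_Icc (s b.1 b.2) (x b.1 = x b.2)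
    have h0 : 0 ≤ cost s x / (N : ℝ) ^ 2 := by positivity
    have h1 : cost s x / (N : ℝ) ^ 2 ≤ 1 := (div_le_one (by positivity)).2 hcost_le
    rw [abs_le]
    constructor <;> simp only [f] <;> linarith [hb.1, hb.2]
  have h := card_abs_sum_ge_le f hf h1 m hε
  have hfilter : (univ.filter fun q : Fin m → Fin N × Fin N =>
      ε * (N : ℝ) ^ 2 ≤ |(N : ℝ) ^ 2 * sampleCost s x q - cost s x|) =
      univ.filter fun q : Fin m → Fin N × Fin N => m * ε ≤ |∑ a, f (q a)| := by
    refine filter_congr fun q _ => ?_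
    have : ∑ a, f (q a) =
        m / (N : ℝ) ^ 2 * ((N : ℝ) ^ 2 * sampleCost s x q - cost s x) := by
      simp only [f, sum_sub_distrib, sum_const, card_univ, Fintype.card_fin, nsmul_eq_mul,
        sampleCost]
      field_simp
    rw [this, abs_mul, abs_of_pos (by positivity : 0 < m / (N : ℝ) ^ 2), div_mul_eq_mul_div,
      le_div_iff₀ (by positivity), mul_assoc]
    exact (mul_le_mul_iff_right₀ hm').symm
  rw [hfilter]
  simpa using h

/-- The estimate is accurate with probability at least `2 / 3`. -/
theorem card_estimate_accurate_ge {k r ℓ m : ℕ} [NeZero k] [NeZero N] (hr : 0 < r) (hℓ : 0 < ℓ)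
    (hm : 0 < m) (p : Fin N → Fin ℓ)
    (hp : ∑ u, ∑ v, (if u ≠ v ∧ p u = p v then (1 : ℝ) else 0) ≤ (N : ℝ) ^ 2 / ℓ)
    {ε : ℝ} (hε : 0 < ε) (hparam : 1 / (k : ℝ) + 24 / r + 12 / ℓ ≤ ε)
    (hexp : 12 * (k : ℝ) ^ (r ^ 2 * ℓ) * Real.exp (-(m * ε ^ 2 / 2)) ≤ 1)
    (G : SignedGraph N)
    [DecidablePred fun ω : (Fin ℓ → Fin (r ^ 2) → Fin N) × (Fin m → Fin N × Fin N) =>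
      |estimate k p ω G.sign - G.weakFrustrationIndex| ≤ ε * (N : ℝ) ^ 2] :
    2 / 3 * (Fintype.card ((Fin ℓ → Fin (r ^ 2) → Fin N) × (Fin m → Fin N × Fin N)) : ℝ) ≤
      (univ.filter fun ω : (Fin ℓ → Fin (r ^ 2) → Fin N) × (Fin m → Fin N × Fin N) =>
        |estimate k p ω G.sign - G.weakFrustrationIndex| ≤ ε * (N : ℝ) ^ 2).card := by
  classical
  set Ω₁ := Fin ℓ → Fin (r ^ 2) → Fin N
  set Ω₂ := Fin m → Fin N × Fin N
  set Λ := Fin ℓ → Fin (r ^ 2) → Fin k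
  obtain ⟨x, hx⟩ := Finite.exists_min fun y : Fin N → Fin k => cost G.sign y
  have hxcost : cost G.sign x ≤ 2 * (G.weakFrustrationIndex : ℝ) + (N : ℝ) ^ 2 / k := by
    obtain ⟨y, hy⟩ := G.exists_cost_le_of_labels k
    exact (hx y).trans hy
  set b := 6 * (4 * (N : ℝ) ^ 2 / r + 2 * (N : ℝ) ^ 2 / ℓ) with hb
  set good := univ.filter fun ω : Ω₁ × Ω₂ =>
    |estimate k p ω G.sign - G.weakFrustrationIndex| ≤ ε * (N : ℝ) ^ 2 with hgood
  let bad₁ := univ.filter fun U : Ω₁ =>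
    ∀ lab : Λ, cost G.sign x + b < cost G.sign (decode G.sign p U lab)
  let bad₂ : Ω₁ → Λ → Finset Ω₂ := fun U lab => univ.filter fun q : Ω₂ =>
    ε * (N : ℝ) ^ 2 ≤ |(N : ℝ) ^ 2 * sampleCost G.sign (decode G.sign p U lab) q -
      cost G.sign (decode G.sign p U lab)|
  have h1 : 6 * (bad₁.card : ℝ) ≤ Fintype.card Ω₁ :=
    card_forall_decode_gt_le hr hℓ G p hp x hx b le_rfl
  have h2 : ∀ U, 6 * ((univ.biUnion (bad₂ U)).card : ℝ) ≤ Fintype.card Ω₂ := by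
    intro U
    have hΛ : (Fintype.card Λ : ℝ) = (k : ℝ) ^ (r ^ 2 * ℓ) := by
      simp only [Λ, Fintype.card_fun, Fintype.card_fin]
      push_cast
      rw [pow_mul]
    calc 6 * ((univ.biUnion (bad₂ U)).card : ℝ) ≤ 6 * ∑ lab, ((bad₂ U lab).card : ℝ) := by
          gcongr; exact_mod_cast card_biUnion_le
      _ ≤ 6 * ∑ _lab : Λ, 2 * ((Fintype.card Ω₂ : ℝ) * Real.exp (-(m * ε ^ 2 / 2))) := by
          gcongr with lab
          exact card_sampleCost_inaccurate_le G.sign _ hm hε.le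
      _ = Fintype.card Ω₂ *
          (12 * (k : ℝ) ^ (r ^ 2 * ℓ) * Real.exp (-(m * ε ^ 2 / 2))) := by
          rw [sum_const, card_univ, nsmul_eq_mul, hΛ]; ring
      _ ≤ Fintype.card Ω₂ := mul_le_of_le_one_right (Nat.cast_nonneg _) hexp
  have hsub : goodᶜ ⊆ (bad₁ ×ˢ univ) ∪ univ.biUnion fun U =>
      ({U} : Finset Ω₁) ×ˢ univ.biUnion (bad₂ U) := by
    rintro ⟨U, q⟩ hω
    by_contra hcon
    simp only [mem_union, mem_product, mem_univ, and_true, mem_biUnion, true_and, mem_singleton,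
      not_or, not_exists, not_and] at hcon
    obtain ⟨hU, hq⟩ := hcon
    have hq' : ∀ lab : Λ, |(N : ℝ) ^ 2 * sampleCost G.sign (decode G.sign p U lab) q -
        cost G.sign (decode G.sign p U lab)| < ε * (N : ℝ) ^ 2 := by
      intro lab
      simpa [bad₂] using hq U rfl lab
    simp only [bad₁, mem_filter, mem_univ, true_and, not_forall, not_lt] at hU
    obtain ⟨lab₀, hlab₀⟩ := hU
    refine mem_compl.1 hω (mem_filter.2 ⟨mem_univ _, ?_⟩)
    have : Nonempty Λ := ⟨lab₀⟩
    obtain ⟨lab₁, hlab₁⟩ := exists_eq_ciInf_of_finite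
      (f := fun lab : Λ => sampleCost G.sign (decode G.sign p U lab) q)
    have hle : (⨅ lab : Λ, sampleCost G.sign (decode G.sign p U lab) q) ≤
        sampleCost G.sign (decode G.sign p U lab₀) q :=
      ciInf_le (Set.finite_range _).bddBelow lab₀
    rw [← hlab₁] at hle
    have e0 := (abs_lt.1 (hq' lab₀)).2
    have e1 := (abs_lt.1 (hq' lab₁)).1
    have e2 := G.two_mul_weakFrustrationIndex_le_cost (decode G.sign p U lab₁)
    have e3 := mul_le_mul_of_nonneg_left hle (sq_nonneg (N : ℝ))
    have e4 := mul_le_mul_of_nonneg_right hparam (sq_nonneg (N : ℝ))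
    have e5 : (1 / (k : ℝ) + 24 / r + 12 / ℓ) * (N : ℝ) ^ 2 = (N : ℝ) ^ 2 / k + b := by
      rw [hb]; ring
    rw [estimate, ← hlab₁, abs_le]
    constructor <;> linarith
  have hcard : ((goodᶜ).card : ℝ) ≤ bad₁.card * Fintype.card Ω₂ +
      ∑ U, ((univ.biUnion (bad₂ U)).card : ℝ) := by
    have := (card_le_card hsub).trans ((card_union_le _ _).trans
      (Nat.add_le_add_left card_biUnion_le _))
    simp only [card_product, card_singleton, one_mul, card_univ] at this
    exact_mod_cast this
  have h3 : ∑ U, 6 * ((univ.biUnion (bad₂ U)).card : ℝ) ≤ Fintype.card Ω₁ * Fintype.card Ω₂ := by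
    refine (sum_le_sum fun U _ => h2 U).trans_eq ?_
    rw [sum_const, card_univ, nsmul_eq_mul]
  have h4 := mul_le_mul_of_nonneg_right h1 (Nat.cast_nonneg (α := ℝ) (Fintype.card Ω₂))
  have h5 : (good.card : ℝ) + (goodᶜ).card = Fintype.card (Ω₁ × Ω₂) := by
    exact_mod_cast card_add_card_compl good
  rw [← mul_sum] at h3
  rw [Fintype.card_prod] at h5 ⊢
  push_cast at h5 ⊢
  linarith

/-- Parameters for which the estimate is accurate with few queries. -/
theorem exists_parameters {ε : ℝ} (hε : 0 < ε) (hε1 : ε ≤ 1) :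
    ∃ k r ℓ m : ℕ, 0 < k ∧ 0 < r ∧ 0 < ℓ ∧ 0 < m ∧ 1 / (k : ℝ) + 24 / r + 12 / ℓ ≤ ε ∧
      12 * (k : ℝ) ^ (r ^ 2 * ℓ) * Real.exp (-(m * ε ^ 2 / 2)) ≤ 1 ∧
      ((m * (2 * r ^ 2 + 1) : ℕ) : ℝ) ≤
        10 ^ 16 * (1 / ε) ^ 7 * (1 + Real.log (1 / ε)) := by
  set M := ⌈1 / ε⌉₊ with hM
  set η := 1 / ε with hη
  have hη1 : 1 ≤ η := (one_le_div hε).2 hε1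
  have hηε : ε * η = 1 := by rw [hη]; field_simp
  have hηM : η ≤ M := Nat.le_ceil _
  have hMη : (M : ℝ) ≤ 2 * η := by linarith [Nat.ceil_lt_add_one (zero_le_one.trans hη1)]
  have hM0 : (0 : ℝ) < M := by linarith
  have hMpos : 0 < M := by exact_mod_cast hM0
  have hMε : 1 / (M : ℝ) ≤ ε := by
    rw [div_le_iff₀ hM0]; nlinarith
  set lg := Real.log (2 * M) with hlg
  have hL : 0 ≤ Real.log η := Real.log_nonneg hη1
  have hlg0 : 0 ≤ lg := Real.log_nonneg (by linarith)
  have hlg1 : lg ≤ 2 * (1 + Real.log η) := by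
    have h1 : lg ≤ Real.log (4 * η) := Real.log_le_log (by positivity) (by linarith)
    rw [Real.log_mul (by norm_num) (by positivity), show (4 : ℝ) = 2 ^ 2 by norm_num,
      Real.log_pow] at h1
    have := Real.log_two_lt_d9
    push_cast at h1
    linarith
  set R : ℝ := 2 * η ^ 2 * ((96 * M) ^ 2 * (48 * M) * lg + 3) with hR
  refine ⟨2 * M, 96 * M, 48 * M, ⌈R⌉₊, by positivity, by positivity, by positivity,
    Nat.ceil_pos.2 (by positivity), ?_, ?_, ?_⟩
  · push_cast
    have : 1 / (2 * (M : ℝ)) + 24 / (96 * M) + 12 / (48 * M) = 1 / M := by field_simp; norm_num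
    rwa [this]
  · have h12 : (12 : ℝ) ≤ Real.exp 3 := by
      have := Real.exp_one_gt_d9
      rw [show (3 : ℝ) = (3 : ℕ) * 1 by norm_num, Real.exp_nat_mul]
      calc (12 : ℝ) ≤ 2.7 ^ 3 := by norm_num
        _ ≤ _ := by gcongr; linarith
    have hk : ((2 * M : ℕ) : ℝ) ^ ((96 * M) ^ 2 * (48 * M)) =
        Real.exp (((96 * M) ^ 2 * (48 * M) : ℝ) * lg) := by
      rw [hlg, mul_comm _ (Real.log _), Real.exp_mul, Real.exp_log (by positivity), ← Real.rpow_natCast]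
      push_cast
      rfl
    have hm : R ≤ ⌈R⌉₊ := Nat.le_ceil _
    have hmε : (96 * M) ^ 2 * (48 * M) * lg + 3 ≤ ⌈R⌉₊ * ε ^ 2 / 2 := by
      have h1 : R * ε ^ 2 / 2 = (96 * M) ^ 2 * (48 * M) * lg + 3 := by
        rw [hR]
        linear_combination ((96 * M) ^ 2 * (48 * M) * lg + 3) * (ε * η + 1) * hηε
      rw [← h1]
      gcongr
    rw [hk]
    calc 12 * Real.exp (((96 * M) ^ 2 * (48 * M) : ℝ) * lg) * Real.exp (-(⌈R⌉₊ * ε ^ 2 / 2))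
        ≤ Real.exp 3 * Real.exp (((96 * M) ^ 2 * (48 * M) : ℝ) * lg) *
            Real.exp (-(⌈R⌉₊ * ε ^ 2 / 2)) := by gcongr
      _ = Real.exp (3 + (96 * M) ^ 2 * (48 * M) * lg + -(⌈R⌉₊ * ε ^ 2 / 2)) := by
          rw [Real.exp_add, Real.exp_add]
      _ ≤ 1 := Real.exp_le_one_iff.2 (by linarith)
  · set X := 1 + Real.log η with hX
    have hX1 : 1 ≤ X := by linarith
    have hm : (⌈R⌉₊ : ℝ) ≤ R + 1 := (Nat.ceil_lt_add_one (by positivity)).le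
    have hη5 : 1 ≤ η ^ 5 := one_le_pow₀ hη1
    have hR2 : R + 1 ≤ (2 * (96 ^ 2 * 48 * 16 + 3) + 1) * (η ^ 5 * X) := by
      have h1 : (96 * (M : ℝ)) ^ 2 * (48 * M) * lg ≤
          (96 * (2 * η)) ^ 2 * (48 * (2 * η)) * (2 * X) := by gcongr
      have h2 : R ≤ 2 * η ^ 2 * ((96 * (2 * η)) ^ 2 * (48 * (2 * η)) * (2 * X) + 3) := by
        rw [hR]; gcongr
      have h3 : η ^ 2 ≤ η ^ 5 * X := by
        calc η ^ 2 = η ^ 2 * 1 * 1 := by ring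
          _ ≤ η ^ 2 * η ^ 3 * X := by gcongr; exact one_le_pow₀ hη1
          _ = _ := by ring
      have h4 : 1 ≤ η ^ 5 * X := one_le_mul_of_one_le_of_one_le hη5 hX1
      linarith
    have hr2 : 2 * (96 * (M : ℝ)) ^ 2 + 1 ≤ (8 * 96 ^ 2 + 1) * η ^ 2 := by
      have h1 : (96 * (M : ℝ)) ^ 2 ≤ (96 * (2 * η)) ^ 2 := by gcongr
      have h2 : 1 ≤ η ^ 2 := one_le_pow₀ hη1
      linarith
    push_cast
    calc (⌈R⌉₊ : ℝ) * (2 * (96 * (M : ℝ)) ^ 2 + 1)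
        ≤ ((2 * (96 ^ 2 * 48 * 16 + 3) + 1) * (η ^ 5 * X)) * ((8 * 96 ^ 2 + 1) * η ^ 2) := by
          gcongr
          exact hm.trans hR2
      _ = ((2 * (96 ^ 2 * 48 * 16 + 3) + 1) * (8 * 96 ^ 2 + 1)) * (η ^ 7 * X) := by ring
      _ ≤ 10 ^ 16 * (η ^ 7 * X) := by gcongr; norm_num
      _ = _ := by ring

/-- Any post-processing of a suitable estimate of the weak frustration index is a query algorithm
with few queries. -/
theorem exists_alg_of_estimate {ε : ℝ} (hε : 0 < ε) (hε1 : ε ≤ 1) (hN : 1 ≤ N) {α : Type}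
    (g : ℝ → α) :
    ∃ A : RandomizedQueryAlg N α,
      A.QueriesAtMost (10 ^ 16 * (1 / ε) ^ 7 * (1 + Real.log (1 / ε))) ∧
      ∀ (G : SignedGraph N) (S : Set α),
        (∀ e : ℝ, |e - G.weakFrustrationIndex| ≤ ε * (N : ℝ) ^ 2 → g e ∈ S) →
        2 / 3 ≤ A.prob G S := by
  classical
  obtain ⟨k, r, ℓ, m, hk, hr, hℓ, hm, hparam, hexp, hqueries⟩ := exists_parameters hε hε1
  have : NeZero k := ⟨hk.ne'⟩
  have : NeZero ℓ := ⟨hℓ.ne'⟩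
  have : NeZero N := ⟨by omega⟩
  have : Nonempty (Fin N) := ⟨0⟩
  obtain ⟨p, hp⟩ := exists_coloring (V := Fin N) ℓ id (fun _ _ => 1) fun _ _ => le_rfl
  simp only [id_eq, Fintype.card_fin] at hp
  obtain ⟨A, hA, hprob⟩ := RandomizedQueryAlg.exists_of_local (m * (2 * r ^ 2 + 1))
    (fun ω : (Fin ℓ → Fin (r ^ 2) → Fin N) × (Fin m → Fin N × Fin N) => estimateQueries p ω)
    (card_estimateQueries_le p) (fun ω s => g (estimate k p ω s))
    (fun ω s s' h => congrArg g (estimate_congr k p ω s s' h))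
  refine ⟨A, fun T hT => (hA T hT).trans hqueries, fun G S hS => hprob G S ?_⟩
  refine (card_estimate_accurate_ge hr hℓ hm p hp hε hparam hexp G).trans ?_
  gcongr with ω
  exact hS _

end SignedGraph

theorem mainTheorem3 :
    ∃ (C : ℝ) (c : ℕ),
      (∀ ε₁ ε₂ : ℝ, 0 ≤ ε₁ → ε₁ < ε₂ → ε₂ ≤ 1 → ∀ N : ℕ, 1 ≤ N →
        ∃ A : RandomizedQueryAlg N Bool,
          A.QueriesAtMost (C * (1 / (ε₂ - ε₁)) ^ 7 * (1 + Real.log (1 / (ε₂ - ε₁))) ^ c) ∧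
          A.IsTolerantTester SignedGraph.IsClusterable ε₁ ε₂) ∧
      (∀ ε : ℝ, 0 < ε → ε ≤ 1 → ∀ N : ℕ, 1 ≤ N →
        ∃ A : RandomizedQueryAlg N ℝ,
          A.QueriesAtMost (C * (1 / ε) ^ 7 * (1 + Real.log (1 / ε)) ^ c) ∧
          A.IsEstimator (fun G => (G.weakFrustrationIndex : ℝ)) (ε * (N : ℝ) ^ 2)) := by
  have hnonneg : ∀ ε : ℝ, 0 < ε → ε ≤ 1 → 0 ≤ Real.log (1 / ε) := fun ε h0 h1 =>
    Real.log_nonneg ((one_le_div h0).2 h1)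
  refine ⟨3 ^ 9 * 10 ^ 16, 1, ?_, ?_⟩
  · intro ε₁ ε₂ h0 hlt h1 N hN
    obtain ⟨ε, hε⟩ : ∃ ε, ε = ε₂ - ε₁ := ⟨_, rfl⟩
    have hε0 : 0 < ε := by linarith
    have hε1 : ε ≤ 1 := by linarith
    have hNpos : (0 : ℝ) < (N : ℝ) ^ 2 := by positivity
    obtain ⟨A, hA, hprob⟩ := SignedGraph.exists_alg_of_estimate (ε := ε / 3) (by linarith)
      (by linarith) hN fun e => decide (e ≤ (ε₁ + ε₂) / 2 * (N : ℝ) ^ 2)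
    rw [← hε]
    refine ⟨A, fun T hT => (hA T hT).trans ?_, fun G hG => ?_, fun G hG => ?_⟩
    · have hL := hnonneg ε hε0 hε1
      have hlog3 : Real.log 3 ≤ 2 := by
        have := Real.log_le_sub_one_of_pos (show (0 : ℝ) < 3 by norm_num)
        linarith
      have hlog : Real.log (1 / (ε / 3)) = Real.log 3 + Real.log (1 / ε) := by
        rw [← Real.log_mul (by norm_num) (by positivity)]
        congr 1
        field_simp
      have h3 : 1 / (ε / 3) = 3 * (1 / ε) := by field_simp
      rw [hlog, h3]
      calc 10 ^ 16 * (3 * (1 / ε)) ^ 7 * (1 + (Real.log 3 + Real.log (1 / ε)))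
          ≤ 10 ^ 16 * (3 * (1 / ε)) ^ 7 * (9 * (1 + Real.log (1 / ε))) := by
            gcongr; linarith
        _ = _ := by ring
    · obtain ⟨H, hH, hHG⟩ := hG
      refine hprob G _ fun e he => ?_
      have h2 := hH.weakFrustrationIndex_le G
      have h3 := (abs_le.1 he).2
      simp only [Set.mem_singleton_iff, decide_eq_true_eq]
      nlinarith
    · obtain ⟨H, -, hH, hHG⟩ := G.exists_weakFrustrationIndex_eq
      refine hprob G _ fun e he => ?_
      have h2 := hG H hH
      rw [hHG] at h2
      have h3 := (abs_le.1 he).1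
      simp only [Set.mem_singleton_iff, decide_eq_false_iff_not, not_le]
      nlinarith
  · intro ε hε hε1 N hN
    obtain ⟨A, hA, hprob⟩ := SignedGraph.exists_alg_of_estimate hε hε1 hN id
    refine ⟨A, fun T hT => (hA T hT).trans ?_, fun G => hprob G _ fun e he => he⟩
    have hL := hnonneg ε hε hε1
    rw [pow_one]
    gcongr
    norm_num
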